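/- **Setting.** Let $A\in\mathbb R^{n\times n}$, $B\in\mathbb R^{n\times m}$, $C\in\mathbb R^{p\times n}$ with $(A,B)$ stabilizable, let $Q_y=Q_y^{T}\ge 0$ and $R=R^{T}>0$, and let $L$ be an observer gain such that all eigenvalues of $A_L=A-LC$ lie strictly inside the unit circle. Write $\det(zI-A_L)=z^n+\alpha_{n-1}z^{n-1}+\dots+\alpha_0$, let $\mathcal A$ be the companion matrix with last row $(-\alpha_0,\dots,-\alpha_{n-1})$ and ones on the superdiagonal, and let $b=(0,\dots,0,1)^T$. Let $\mathcal A_\varepsilon\in\mathbb R^{n\times n}$ have the same characteristic polynomial as $A_L$. For $F\in\mathbb R^{n\times n}$ and $v\in\mathbb R^n$ let $N(F,v)\in\mathbb R^{n\times n}$ be the matrix with $\operatorname{adj}(zI-F)v=N(F,v)\,(1,z,\dots,z^{n-1})^T$, and choose $\eta_\varepsilon(0)$ with $N(\mathcal A_\varepsilon,\eta_\varepsilon(0))$ nonsingular. **Data.** For an arbitrary input sequence $u(k)$ let $x(k+1)=Ax(k)+Bu(k)$, $y(k)=Cx(k)$, and let $\eta=\operatorname{col}(\eta_u^1,\dots,\eta_u^m,\eta_y^1,\dots,\eta_y^p,\eta_\varepsilon)\in\mathbb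 R^{n_z}$, $n_z=n(m+p+1)$, be generated by $\eta_u^i(k+1)=\mathcal A\eta_u^i(k)+b\,u_i(k)$, $\eta_y^i(k+1)=\mathcal A\eta_y^i(k)+b\,y_i(k)$, $\eta_\varepsilon(k+1)=\mathcal A_\varepsilon\eta_\varepsilon(k)$ with $\eta_u^i(0)=\eta_y^i(0)=0$ and the chosen $\eta_\varepsilon(0)$. The parameterization matrix is $$M=[N(A_L,B_1),\dots,N(A_L,B_m),\,N(A_L,L_1),\dots,N(A_L,L_p),\,N(A_L,x(0))N(\mathcal A_\varepsilon,\eta_\varepsilon(0))^{-1}]\in\mathbb R^{n\times n_z},$$ where $B_i,L_i$ are the columns of $B,L$. Let $\operatorname{vec}$ stack the columns of a matrix, let $\operatorname{vech}$ stack the entries $c_{ij}$, $i\le j$, of a symmetric matrix, let $\delta_v=\operatorname{vech}(2vv^T-\operatorname{diag}(v)^2)^T$, $\varphi(k)=[\delta_{\eta(k)},\,2(u(k)\otimes\eta(k))^T,\,\delta_{u(k)}]$, and let $\Pi(k_N)$ be the matrix with rows $\varphi(0),\dots,\varphi(k_N)$. **Scheme.** For a utility sequence $c(k)$ and a symmetric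 matrix $P$, consider the linear equations $$\varphi(k)\operatorname{col}\big(\operatorname{vech}\mathcal P_{\eta\eta},\operatorname{vec}\mathcal P_{\eta u},\operatorname{vech}\mathcal P_{uu}\big)=\delta_{\eta(k+1)}\operatorname{vech}(P)+c(k),\qquad k=0,\dots,k_N,\tag{1}$$ in the unknowns $\mathcal P_{\eta\eta}=\mathcal P_{\eta\eta}^T\in\mathbb R^{n_z\times n_z}$, $\mathcal P_{\eta u}\in\mathbb R^{n_z\times m}$, $\mathcal P_{uu}=\mathcal P_{uu}^T\in\mathbb R^{m\times m}$. Given $\mathcal P_0=\mathcal P_0^T\ge0$ and $Q_\varepsilon=Q_\varepsilon^T>0$, the model-free value iteration with the modified utility $\tilde{\mathcal C}(k)=\eta(k)^TQ_\varepsilon\eta(k)+y(k)^TQ_yy(k)+u(k)^TRu(k)$ solves, for $j=0,1,2,\dots$, (1) with $P=\mathcal P_j$, $c=\tilde{\mathcal C}$, and sets $\mathcal P_{j+1}=\mathcal P_{\eta\eta}-\mathcal P_{\eta u}\mathcal P_{uu}^{-1}\mathcal P_{\eta u}^T$. Moreover let $(\bar{\mathcal P}_{\eta\eta},\bar{\mathcal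 P}_{\eta u},\bar{\mathcal P}_{uu})$ solve (1) with $P=\mathcal P_j$ and $c(k)=u(k)^TRu(k)$, put $\mathcal K_j=\bar{\mathcal P}_{uu}^{-1}\bar{\mathcal P}_{\eta u}^T$ and $$H_j=\bar{\mathcal P}_{\eta\eta}-2\bar{\mathcal P}_{\eta u}\mathcal K_j+\mathcal K_j^T\bar{\mathcal P}_{uu}\mathcal K_j-\mathcal P_j,$$ and let $\mathcal H_j(P_j,K_j)$ be the last $n\times n$ diagonal block of $H_j$. **Claim.** If $\operatorname{rank}\Pi(k_N)=\frac{(n_z+m)(n_z+m+1)}2$ and $\operatorname{rank}M=n$, then for all symmetric $Q_\varepsilon>0$ and $\mathcal P_0\ge0$ the scheme is well defined (all the linear systems above have exactly one solution), and there is an iteration $j$ with $\mathcal H_j(P_j,K_j)<0$. -/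

import Mathlib

open Matrix
open scoped Kronecker

noncomputable section

namespace ModelFreeVI

/-- All complex eigenvalues of the real matrix `F` lie strictly inside the unit circle. -/
def IsSchur {ι : Type*} [Fintype ι] [DecidableEq ι] (F : Matrix ι ι ℝ) : Prop :=
  ∀ z ∈ spectrum ℂ (F.map (algebraMap ℝ ℂ)), ‖z‖ < 1

/-- The pair `(A, B)` is stabilizable. -/
def Stabilizable {n m : ℕ} (A : Matrix (Fin n) (Fin n) ℝ) (B : Matrix (Fin n) (Fin m) ℝ) : Prop :=
  ∃ K : Matrix (Fin m) (Fin n) ℝ, IsSchur (A - B * K)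

/-- Negative definiteness of a real (symmetric) matrix. -/
def NegDef {ι : Type*} [Fintype ι] (F : Matrix ι ι ℝ) : Prop := (-F).PosDef

/-! ### The internal model and its parameterization matrix -/

/-- Index set of the internal state `η = col(η_u^1, …, η_u^m, η_y^1, …, η_y^p, η_ε)`, where each of
the `m + p + 1` blocks has `n` entries; its cardinality is `n_z = n (m + p + 1)`. -/
abbrev EtaIdx (n m p : ℕ) : Type := (Fin m × Fin n) ⊕ ((Fin p × Fin n) ⊕ Fin n)

/-- Index set of the stacked input `ζ = col(u, y, 0)` of the internal model. -/
abbrev ZetaIdx (m p : ℕ) : Type := Fin m ⊕ (Fin p ⊕ Unit)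

/-- The companion matrix with last row `-α₀, …, -α_{n-1}` of the characteristic polynomial
`z ^ n + α_{n-1} z ^ (n-1) + ⋯ + α₀` of `AL`. -/
def companion {n : ℕ} (AL : Matrix (Fin n) (Fin n) ℝ) : Matrix (Fin n) (Fin n) ℝ :=
  Matrix.of fun i j =>
    if (i : ℕ) + 1 = n then -(AL.charpoly.coeff (j : ℕ))
    else if (j : ℕ) = (i : ℕ) + 1 then 1 else 0

/-- The column vector `b = (0, …, 0, 1)`. -/
def lastVec (n : ℕ) : Fin n → ℝ := fun i => if (i : ℕ) + 1 = n then 1 else 0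

/-- `𝒢₁ = block diag [𝒜, …, 𝒜, 𝒜_ε]` with `m + p` copies of the companion matrix `𝒜`. -/
def gOne {n : ℕ} (m p : ℕ) (AL Aε : Matrix (Fin n) (Fin n) ℝ) :
    Matrix (EtaIdx n m p) (EtaIdx n m p) ℝ :=
  Matrix.fromBlocks ((1 : Matrix (Fin m) (Fin m) ℝ) ⊗ₖ companion AL) 0 0
    (Matrix.fromBlocks ((1 : Matrix (Fin p) (Fin p) ℝ) ⊗ₖ companion AL) 0 0 Aε)

/-- `block diag [b, …, b]` with `q` copies of `b`. -/
def bBlocks (n q : ℕ) : Matrix (Fin q × Fin n) (Fin q) ℝ :=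
  Matrix.of fun a i => if a.1 = i then lastVec n a.2 else 0

/-- `𝒢₂ = block diag [b, …, b, 0]` with `m + p` copies of `b`. -/
def gTwo (n m p : ℕ) : Matrix (EtaIdx n m p) (ZetaIdx m p) ℝ :=
  Matrix.fromBlocks (bBlocks n m) 0 0 (Matrix.fromBlocks (bBlocks n p) 0 0 0)

/-- `ζ = col(u, y, 0)`. -/
def zeta {m p : ℕ} (u : Fin m → ℝ) (y : Fin p → ℝ) : ZetaIdx m p → ℝ :=
  Sum.elim u (Sum.elim y 0)

/-- The initial internal state `col(0, …, 0, η_ε(0))`. -/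
def etaInit {n : ℕ} (m p : ℕ) (ηε0 : Fin n → ℝ) : EtaIdx n m p → ℝ :=
  Sum.elim 0 (Sum.elim 0 ηε0)

/-- The coefficient matrix of the polynomial vector `adj(z I - F) v`: its `c`-th column is the
coefficient of `z ^ c`, so that
`adj(z I - F) v = adjCoeff F v * col(1, z, …, z ^ (n-1))`. -/
def adjCoeff {n : ℕ} (F : Matrix (Fin n) (Fin n) ℝ) (v : Fin n → ℝ) :
    Matrix (Fin n) (Fin n) ℝ :=
  Matrix.of fun a c =>
    ((F.charmatrix.adjugate.map fun q => q.coeff (c : ℕ)) *ᵥ v) a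

/-- `M_{ε_x ← η_ε} = M_{ε_x} M_{η_ε}⁻¹`, where `ε0` is the initial observer error. -/
def errMatrix {n : ℕ} (AL Aε : Matrix (Fin n) (Fin n) ℝ) (ε0 ηε0 : Fin n → ℝ) :
    Matrix (Fin n) (Fin n) ℝ :=
  adjCoeff AL ε0 * (adjCoeff Aε ηε0)⁻¹

/-- The parameterization matrix `M = [M_u^1, …, M_u^m, M_y^1, …, M_y^p, M_{ε_x ← η_ε}]`; the block
of the `i`-th column `f` of `B` (or of `L`) holds the coefficients of the numerators of
`(z I - (A - L C))⁻¹ f`. -/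
def paramMatrix {n m p : ℕ} (A : Matrix (Fin n) (Fin n) ℝ) (B : Matrix (Fin n) (Fin m) ℝ)
    (C : Matrix (Fin p) (Fin n) ℝ) (L : Matrix (Fin n) (Fin p) ℝ)
    (Aε : Matrix (Fin n) (Fin n) ℝ) (ε0 ηε0 : Fin n → ℝ) :
    Matrix (Fin n) (EtaIdx n m p) ℝ :=
  Matrix.fromCols
    (Matrix.of fun a (ic : Fin m × Fin n) => adjCoeff (A - L * C) (fun r => B r ic.1) a ic.2)
    (Matrix.fromCols
      (Matrix.of fun a (ic : Fin p × Fin n) => adjCoeff (A - L * C) (fun r => L r ic.1) a ic.2)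
      (errMatrix (A - L * C) Aε ε0 ηε0))

/-! ### Data regressors -/

section Regressors

variable {ι κ : Type*}

/-- Half-vectorization of a symmetric matrix: the entry at the unordered pair `{i, j}` is `C i j`
(written symmetrically in `i` and `j`). -/
def vech (C : Matrix ι ι ℝ) : Sym2 ι → ℝ :=
  Sym2.lift ⟨fun i j => (C i j + C j i) / 2, fun i j => congrArg (· / 2) (add_comm (C i j) (C j i))⟩

/-- `δ_v = vech(2 v vᵀ - dia(v)²)ᵀ`. -/
def delta [Fintype ι] [DecidableEq ι] (v : ι → ℝ) : Sym2 ι → ℝ :=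
  vech ((2 : ℝ) • Matrix.vecMulVec v v - Matrix.diagonal v ^ 2)

/-- `δ_{v,w} = (w ⊗ v)ᵀ`. -/
def deltaMixed (v : ι → ℝ) (w : κ → ℝ) : κ × ι → ℝ := fun s => w s.1 * v s.2

/-- Index set of the unknowns `col(vech 𝒫_{η,η}, vec 𝒫_{η,u}, vech 𝒫_{u,u})`. -/
abbrev ParamIdx (ι κ : Type*) : Type _ := Sym2 ι ⊕ ((κ × ι) ⊕ Sym2 κ)

/-- `φ = [δ_η, 2 δ_{η,u}, δ_u]`. -/
def phi [Fintype ι] [DecidableEq ι] [Fintype κ] [DecidableEq κ] (η : ι → ℝ) (u : κ → ℝ) :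
    ParamIdx ι κ → ℝ :=
  Sum.elim (delta η) (Sum.elim ((2 : ℝ) • deltaMixed η u) (delta u))

/-- `Π(k_N) = col(φ(0), …, φ(k_N))`. -/
def regPi [Fintype ι] [DecidableEq ι] [Fintype κ] [DecidableEq κ]
    (η : ℕ → ι → ℝ) (u : ℕ → κ → ℝ) (kN : ℕ) : Matrix (Fin (kN + 1)) (ParamIdx ι κ) ℝ :=
  Matrix.of fun k => phi (η k) (u k)

/-- `Ψ(k_N) = col(ψ(0), …, ψ(k_N))` with `ψ(k) = δ_η(k + 1)`. -/
def regPsi [Fintype ι] [DecidableEq ι] (η : ℕ → ι → ℝ) (kN : ℕ) :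
    Matrix (Fin (kN + 1)) (Sym2 ι) ℝ :=
  Matrix.of fun k => delta (η ((k : ℕ) + 1))

/-- A triple of matrices `(𝒫_{η,η}, 𝒫_{η,u}, 𝒫_{u,u})`. -/
structure Params (ι κ : Type*) where
  ηη : Matrix ι ι ℝ
  ηu : Matrix ι κ ℝ
  uu : Matrix κ κ ℝ

/-- `col(vech 𝒫_{η,η}, vec 𝒫_{η,u}, vech 𝒫_{u,u})`. -/
def Params.toVec (θ : Params ι κ) : ParamIdx ι κ → ℝ :=
  Sum.elim (vech θ.ηη) (Sum.elim (Matrix.vec θ.ηu) (vech θ.uu))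

/-- `θ` (with symmetric diagonal blocks) solves the data-based learning equation
`Π(k_N) col(vech 𝒫_{η,η}, vec 𝒫_{η,u}, vech 𝒫_{u,u}) = Ψ(k_N) vech(P) + col(c(0), …, c(k_N))`
with utility values `c`. -/
def SolvesLearning [Fintype ι] [DecidableEq ι] [Fintype κ] [DecidableEq κ]
    (η : ℕ → ι → ℝ) (u : ℕ → κ → ℝ) (kN : ℕ) (c : ℕ → ℝ) (P : Matrix ι ι ℝ)
    (θ : Params ι κ) : Prop :=
  θ.ηη.IsSymm ∧ θ.uu.IsSymm ∧
    regPi η u kN *ᵥ θ.toVec = regPsi η kN *ᵥ vech P + fun k : Fin (kN + 1) => c k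

/-- The value update `𝒫_{η,η} - 𝒫_{η,u} 𝒫_{u,u}⁻¹ 𝒫_{η,u}ᵀ`. -/
def Params.value [Fintype κ] [DecidableEq κ] (θ : Params ι κ) : Matrix ι ι ℝ :=
  θ.ηη - θ.ηu * θ.uu⁻¹ * θ.ηuᵀ

/-- The control gain `𝒫_{u,u}⁻¹ 𝒫_{η,u}ᵀ`. -/
def Params.gain [Fintype κ] [DecidableEq κ] (θ : Params ι κ) : Matrix κ ι ℝ :=
  θ.uu⁻¹ * θ.ηuᵀ

/-- The data available at one iteration: the value matrix `𝒫_j`, the solution of the learning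
equation, and the solution of the auxiliary equation used by the stability criterion. -/
structure Iterate (ι κ : Type*) where
  P : Matrix ι ι ℝ
  θ : Params ι κ
  θaux : Params ι κ

/-- `s` is a run of the model-free value iteration scheme started from `P0`, with utility values
`c`; along the run the auxiliary equation, in which the utility is replaced by `caux`, is solved
as well. -/
structure IsVIRun [Fintype ι] [DecidableEq ι] [Fintype κ] [DecidableEq κ]
    (η : ℕ → ι → ℝ) (u : ℕ → κ → ℝ) (kN : ℕ) (c caux : ℕ → ℝ) (P0 : Matrix ι ι ℝ)
    (s : ℕ → Iterate ι κ) : Prop where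
  init : (s 0).P = P0
  solves : ∀ j, SolvesLearning η u kN c (s j).P (s j).θ
  update : ∀ j, (s (j + 1)).P = (s j).θ.value
  solves_aux : ∀ j, SolvesLearning η u kN caux (s j).P (s j).θaux

/-- `H_j = 𝒫̄_{η,η} - 2 𝒫_{η,u} 𝒦_j + 𝒦_jᵀ 𝒫_{u,u} 𝒦_j - 𝒫_j`, from the solution of the auxiliary
equation. -/
def Iterate.bigH [Fintype κ] [DecidableEq κ] (s : Iterate ι κ) : Matrix ι ι ℝ :=
  s.θaux.ηη - (2 : ℝ) • (s.θaux.ηu * s.θaux.gain)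
    + s.θaux.gainᵀ * s.θaux.uu * s.θaux.gain - s.P

end Regressors

/-- `ℋ_j`: the last `n × n` diagonal block of `H_j`. -/
def Iterate.calH {n m p : ℕ} (s : Iterate (EtaIdx n m p) (Fin m)) : Matrix (Fin n) (Fin n) ℝ :=
  s.bigH.toBlocks₂₂.toBlocks₂₂

/-- The modified utility `ηᵀ Q_ε η + yᵀ Q_y y + uᵀ R u` along the data. -/
def modifiedUtility {ι κ o : Type*} [Fintype ι] [Fintype κ] [Fintype o]
    (Qε : Matrix ι ι ℝ) (Qy : Matrix o o ℝ) (R : Matrix κ κ ℝ)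
    (η : ℕ → ι → ℝ) (y : ℕ → o → ℝ) (u : ℕ → κ → ℝ) (k : ℕ) : ℝ :=
  η k ⬝ᵥ Qε *ᵥ η k + y k ⬝ᵥ Qy *ᵥ y k + u k ⬝ᵥ R *ᵥ u k

/-- The auxiliary utility `uᵀ R u` along the data. -/
def inputUtility {κ : Type*} [Fintype κ] (R : Matrix κ κ ℝ) (u : ℕ → κ → ℝ) (k : ℕ) : ℝ :=
  u k ⬝ᵥ R *ᵥ u k

end ModelFreeVI

end

open ModelFreeVI

/-!
The coefficient matrix `N(F, v)` of `adj(z I - F) v` intertwines `F` with the companion matrix of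
its characteristic polynomial and maps `(0, …, 0, 1)` to `v` (`adjCoeff_mul_companion`,
`adjCoeff_mulVec_lastVec`). Hence `M` maps the internal model to the observer, and `x = M η` along
the data (`state_eq_paramMatrix_mulVec`). Substituting `y = C M η`, the internal state obeys a
linear system `η⁺ = 𝒜 η + ℬ u` with `M 𝒜 = A M` and `M ℬ = B`, and the modified utility is
`ηᵀ Q η + uᵀ R u` with `Q = Q_ε + (C M)ᵀ Q_y (C M) > 0`.

Since `Π(k_N)` has full column rank, each learning equation has exactly one solution, namely the
model-based parameters `(𝒜ᵀP𝒜 + Q, 𝒜ᵀPℬ, ℬᵀPℬ + R)`, so the scheme is the iteration of the Riccati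
map of `(𝒜, ℬ, Q, R)`, and `H_j = P_{j+1} - P_j - Q` (`isVIRun_modelRun`, `IsVIRun.unique`,
`bigH_modelRun`). It remains to find `j` with `P_{j+1} - P_j < Q`.

If `A - B K` is Schur, then so is `𝒜 - ℬ K M`, as a cascade of `A - B K` and the stable internal
model (`isSchur_augmentedMatrix_sub`). A Lyapunov inequality for this fixed feedback bounds the
iterates: `P_j ≤ c Q` for all `j` (`exists_riccatiIter_le`). The Riccati map `f` is monotone and
satisfies `f (t P) ≥ t f(P) + (1 - t) Q` for `0 ≤ t ≤ 1`. Starting from `0 • P_1 ≤ P_0`, induction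
gives `t_j P_{j+1} ≤ P_j` with `1 - t_j = (1 - 1/c) ^ j` (`smul_riccatiIter_succ_le`). So
`P_{j+1} - P_j ≤ (1 - t_j) c Q`, which is below `Q` for large `j`, without any appeal to the limit
of the iteration or to the algebraic Riccati equation.
-/

namespace ModelFreeVI

/-! ### The Loewner order on real matrices -/

section Loewner

open scoped MatrixOrder

variable {ι κ : Type*}

lemma transpose_mul_mul_le [Fintype ι] [Fintype κ] {P P' : Matrix ι ι ℝ} (h : P ≤ P')
    (F : Matrix ι κ ℝ) :
    Fᵀ * P * F ≤ Fᵀ * P' * F := by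
  rw [Matrix.le_iff, ← Matrix.sub_mul, ← Matrix.mul_sub,
    ← conjTranspose_eq_transpose_of_trivial]
  exact (Matrix.le_iff.1 h).conjTranspose_mul_mul_same F

lemma transpose_mul_mul_nonneg [Fintype ι] [Fintype κ] {P : Matrix ι ι ℝ} (h : 0 ≤ P)
    (F : Matrix ι κ ℝ) :
    0 ≤ Fᵀ * P * F := by
  simpa using transpose_mul_mul_le h F

/-- The largest eigenvalue of a positive semidefinite matrix is at most the sum of all of them. -/
lemma le_trace_smul_one [Fintype ι] [DecidableEq ι] {T : Matrix ι ι ℝ} (hT : 0 ≤ T) :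
    T ≤ T.trace • (1 : Matrix ι ι ℝ) := by
  have hT' := nonneg_iff_posSemidef.1 hT
  rw [← Algebra.algebraMap_eq_smul_one]
  refine le_algebraMap_of_spectrum_le (fun x hx => ?_) hT'.isHermitian
  rw [hT'.isHermitian.spectrum_real_eq_range_eigenvalues] at hx
  obtain ⟨i, rfl⟩ := hx
  rw [hT'.isHermitian.trace_eq_sum_eigenvalues]
  exact Finset.single_le_sum (f := fun i => hT'.isHermitian.eigenvalues i)
    (fun j _ => hT'.eigenvalues_nonneg j) (Finset.mem_univ i)

lemma exists_one_le_smul_of_posDef [Fintype ι] [DecidableEq ι] {Q : Matrix ι ι ℝ}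
    (hQ : Q.PosDef) :
    ∃ c : ℝ, 0 < c ∧ 1 ≤ c • Q := by
  -- The spectral criterion needs a nontrivial matrix algebra.
  cases isEmpty_or_nonempty ι
  · exact ⟨1, one_pos, le_of_eq (Subsingleton.elim _ _)⟩
  obtain ⟨r, hr, h⟩ := (CFC.exists_pos_algebraMap_le_iff (a := Q) hQ.isHermitian).2
    fun x hx => ((isStrictlyPositive_iff_posDef).2 hQ).spectrum_pos hx
  refine ⟨r⁻¹, inv_pos.2 hr, ?_⟩
  have := smul_le_smul_of_nonneg_left h (inv_pos.2 hr).le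
  rwa [Algebra.algebraMap_eq_smul_one, smul_smul, inv_mul_cancel₀ hr.ne', one_smul] at this

lemma posDef_of_posDef_le {P P' : Matrix ι ι ℝ} (hP : P.PosDef) (h : P ≤ P') : P'.PosDef := by
  have := hP.add_posSemidef (Matrix.le_iff.1 h)
  rwa [add_sub_cancel] at this

lemma isSymm_of_nonneg {P : Matrix ι ι ℝ} (hP : 0 ≤ P) : P.IsSymm := by
  have := (nonneg_iff_posSemidef.1 hP).isHermitian
  rwa [IsHermitian, conjTranspose_eq_transpose_of_trivial] at this

end Loewner

/-! ### Powers of Schur matrices and Lyapunov inequalities -/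

section Schur

open scoped MatrixOrder
open Filter Topology

variable {ι : Type*} [Fintype ι] [DecidableEq ι]

/-- Gelfand's formula, applied to the complexification of `F`. -/
lemma IsSchur.tendsto_pow_zero {F : Matrix ι ι ℝ} (hF : IsSchur F) :
    Tendsto (fun k => F ^ k) atTop (𝓝 0) := by
  let _ : NormedRing (Matrix ι ι ℂ) := Matrix.linftyOpNormedRing
  let _ : NormedAlgebra ℂ (Matrix ι ι ℂ) := Matrix.linftyOpNormedAlgebra
  set G := F.map (algebraMap ℝ ℂ) with hG
  have hG0 : Tendsto (fun k => G ^ k) atTop (𝓝 0) := by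
    cases isEmpty_or_nonempty ι
    · exact tendsto_const_nhds.congr fun k => Subsingleton.elim _ _
    have hlt : spectralRadius ℂ G < 1 := by
      have := spectrum.spectralRadius_lt_of_forall_lt G (r := 1) fun z hz => by
        exact_mod_cast hF z hz
      simpa using this
    obtain ⟨r, hr, hr1⟩ := exists_between hlt
    have hlim := spectrum.pow_nnnorm_pow_one_div_tendsto_nhds_spectralRadius G
    have hev := hlim.eventually (gt_mem_nhds hr)
    lift r to NNReal using (hr1.trans ENNReal.one_lt_top).ne
    have hr1' : (r : ℝ) < 1 := by exact_mod_cast hr1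
    refine squeeze_zero_norm' ?_ (tendsto_pow_atTop_nhds_zero_of_lt_one r.coe_nonneg hr1')
    filter_upwards [hev, eventually_gt_atTop 0] with k hk hk0
    have hk0' : (0 : ℝ) < k := by exact_mod_cast hk0
    have h1 := ENNReal.rpow_le_rpow hk.le hk0'.le
    rw [← ENNReal.rpow_mul, one_div_mul_cancel hk0'.ne', ENNReal.rpow_one,
      ENNReal.rpow_natCast] at h1
    exact_mod_cast h1
  refine tendsto_pi_nhds.2 fun i => tendsto_pi_nhds.2 fun j => ?_
  have h3 := (Complex.continuous_re.tendsto _).comp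
    (tendsto_pi_nhds.1 (tendsto_pi_nhds.1 hG0 i) j)
  refine h3.congr fun k => ?_
  have : G ^ k = (F ^ k).map (algebraMap ℝ ℂ) := by
    rw [hG, ← RingHom.mapMatrix_apply, ← map_pow]; rfl
  simp [this]

lemma IsSchur.exists_pow_contracts {F : Matrix ι ι ℝ} (hF : IsSchur F) :
    ∃ N : ℕ, 0 < N ∧ (F ^ N)ᵀ * F ^ N ≤ (1 / 2 : ℝ) • (1 : Matrix ι ι ℝ) := by
  have hc : Continuous fun X : Matrix ι ι ℝ => (Xᵀ * X).trace := by fun_prop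
  have h := (hc.tendsto 0).comp hF.tendsto_pow_zero
  have h0 : ((0 : Matrix ι ι ℝ)ᵀ * (0 : Matrix ι ι ℝ)).trace < 1 / 2 := by simp
  obtain ⟨N, hN, hN0⟩ := ((h.eventually (gt_mem_nhds h0)).and (eventually_gt_atTop 0)).exists
  have hnn : 0 ≤ (F ^ N)ᵀ * F ^ N := by
    simpa using transpose_mul_mul_nonneg (zero_le_one' (Matrix ι ι ℝ)) (F ^ N)
  exact ⟨N, hN0, (le_trace_smul_one hnn).trans (smul_le_smul_of_nonneg_right hN.le zero_le_one)⟩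

/-- A Lyapunov inequality with prescribed decrease and prescribed lower bound. A finite sum of the
Gram matrices of the powers of `F` suffices, because a single power of `F` is a contraction. -/
lemma IsSchur.exists_lyapunov {F : Matrix ι ι ℝ} (hF : IsSchur F) {S T : Matrix ι ι ℝ}
    (hS : 0 ≤ S) (hT : 0 ≤ T) :
    ∃ X : Matrix ι ι ℝ, T ≤ X ∧ Fᵀ * X * F + S ≤ X := by
  obtain ⟨N, hN, hcon⟩ := hF.exists_pow_contracts
  set s : ℝ := S.trace + T.trace
  have hst : 0 ≤ S.trace := (nonneg_iff_posSemidef.1 hS).trace_nonneg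
  have htt : 0 ≤ T.trace := (nonneg_iff_posSemidef.1 hT).trace_nonneg
  have hs : 0 ≤ s := add_nonneg hst htt
  have h1 : (0 : Matrix ι ι ℝ) ≤ 1 := zero_le_one
  have hSs : S ≤ s • 1 := (le_trace_smul_one hS).trans
    (smul_le_smul_of_nonneg_right (by simp only [s]; linarith) h1)
  have hTs : T ≤ s • 1 := (le_trace_smul_one hT).trans
    (smul_le_smul_of_nonneg_right (by simp only [s]; linarith) h1)
  set g : ℕ → Matrix ι ι ℝ := fun i => (F ^ i)ᵀ * F ^ i with hg
  have hg0 : ∀ i, 0 ≤ g i := fun i => by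
    simpa [hg] using transpose_mul_mul_nonneg h1 (F ^ i)
  have hshift : ∀ i, Fᵀ * g i * F = g (i + 1) := fun i => by
    simp only [hg, pow_succ, Matrix.transpose_mul, Matrix.mul_assoc]
  have hg1 : g 0 = 1 := by simp [hg]
  set Y := ∑ i ∈ Finset.range N, g i with hY
  have hFY : Fᵀ * Y * F = Y + g N - 1 := by
    rw [hY, Finset.mul_sum, Finset.sum_mul, Finset.sum_congr rfl fun i _ => hshift i,
      eq_sub_iff_add_eq, ← hg1, ← Finset.sum_range_succ', Finset.sum_range_succ]
  have h1Y : 1 ≤ Y := by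
    rw [← hg1]
    exact Finset.single_le_sum (fun i _ => hg0 i) (Finset.mem_range.2 hN)
  -- The decrease of `(2 s) Y` is `2 s (1 - g N) ≥ 2 s (1 - 1/2) = s`, which dominates `S`.
  refine ⟨(2 * s) • Y, ?_, ?_⟩
  · calc T ≤ s • 1 := hTs
      _ ≤ (2 * s) • 1 := smul_le_smul_of_nonneg_right (by linarith) h1
      _ ≤ (2 * s) • Y := smul_le_smul_of_nonneg_left h1Y (by linarith)
  · have h2 : (2 * s) • g N ≤ s • 1 := by
      have := smul_le_smul_of_nonneg_left hcon (show 0 ≤ 2 * s by linarith)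
      rwa [smul_smul, show 2 * s * (1 / 2) = s by ring] at this
    calc Fᵀ * ((2 * s) • Y) * F + S = (2 * s) • Y + (2 * s) • g N - (2 * s) • 1 + S := by
          rw [Matrix.mul_smul, Matrix.smul_mul, hFY, smul_sub, smul_add]
      _ ≤ (2 * s) • Y + s • 1 - (2 * s) • 1 + s • 1 := by gcongr
      _ = (2 * s) • Y := by module

end Schur

/-! ### Value iteration for the linear-quadratic problem -/

section Riccati

open scoped MatrixOrder

variable {ι κ : Type*} [Fintype ι] [Fintype κ]

/-- The parameters `(AᵀPA + Q, AᵀPB, BᵀPB + R)` of the state-input value function of the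
linear-quadratic problem with data `(A, B, Q, R)` and terminal weight `P`. -/
def valueParams (A : Matrix ι ι ℝ) (B : Matrix ι κ ℝ) (Q : Matrix ι ι ℝ) (R : Matrix κ κ ℝ)
    (P : Matrix ι ι ℝ) : Params ι κ where
  ηη := Aᵀ * P * A + Q
  ηu := Aᵀ * P * B
  uu := Bᵀ * P * B + R

/-- The cost after one step under the feedback `u = -Kη`, with terminal weight `P`. -/
def feedbackCost (A : Matrix ι ι ℝ) (B : Matrix ι κ ℝ) (Q : Matrix ι ι ℝ) (R : Matrix κ κ ℝ)
    (P : Matrix ι ι ℝ) (K : Matrix κ ι ℝ) : Matrix ι ι ℝ :=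
  (A - B * K)ᵀ * P * (A - B * K) + Kᵀ * R * K + Q

variable {A : Matrix ι ι ℝ} {B : Matrix ι κ ℝ} {Q : Matrix ι ι ℝ} {R : Matrix κ κ ℝ}

lemma valueParams_uu_posDef (hR : R.PosDef) {P : Matrix ι ι ℝ} (hP : 0 ≤ P) :
    (valueParams A B Q R P).uu.PosDef :=
  hR.posSemidef_add (nonneg_iff_posSemidef.1 (transpose_mul_mul_nonneg hP B))

variable [DecidableEq κ]

/-- Completion of the square. -/
lemma feedbackCost_eq (hR : R.PosDef) {P : Matrix ι ι ℝ} (hP : 0 ≤ P) (K : Matrix κ ι ℝ) :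
    feedbackCost A B Q R P K = (valueParams A B Q R P).value
      + (K - (valueParams A B Q R P).gain)ᵀ * (valueParams A B Q R P).uu
        * (K - (valueParams A B Q R P).gain) := by
  have hPD := valueParams_uu_posDef (A := A) (B := B) (Q := Q) hR hP
  have hPs : Pᵀ = P := isSymm_of_nonneg hP
  have hUs : (valueParams A B Q R P).uuᵀ = (valueParams A B Q R P).uu :=
    isSymm_of_nonneg (nonneg_iff_posSemidef.2 hPD.posSemidef)
  have hU : IsUnit (valueParams A B Q R P).uu.det := hPD.det_pos.ne'.isUnit
  set U := (valueParams A B Q R P).uu with hUdef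
  have hUi : U * U⁻¹ = 1 := Matrix.mul_nonsing_inv _ hU
  have hUi' : U⁻¹ * U = 1 := Matrix.nonsing_inv_mul _ hU
  set V := (valueParams A B Q R P).ηu with hV
  have hVt : Vᵀ = Bᵀ * P * A := by
    simp [hV, valueParams, Matrix.transpose_mul, hPs, Matrix.mul_assoc]
  have hVd : V = Aᵀ * P * B := rfl
  have hRU : R = U - Bᵀ * P * B := by simp [hUdef, valueParams]
  have key : (K - U⁻¹ * Vᵀ)ᵀ * U * (K - U⁻¹ * Vᵀ)
      = Kᵀ * U * K - Kᵀ * Vᵀ - V * K + V * U⁻¹ * Vᵀ := by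
    have hUit : U⁻¹ᵀ = U⁻¹ := by rw [Matrix.transpose_nonsing_inv, hUs]
    rw [Matrix.transpose_sub, Matrix.transpose_mul, Matrix.transpose_transpose, hUit]
    have e1 : (Kᵀ - V * U⁻¹) * U * (K - U⁻¹ * Vᵀ)
        = Kᵀ * U * K - Kᵀ * (U * U⁻¹) * Vᵀ - V * (U⁻¹ * U) * K
          + V * (U⁻¹ * U) * U⁻¹ * Vᵀ := by
      simp only [Matrix.mul_sub, Matrix.sub_mul, Matrix.mul_assoc]
      abel
    rw [e1, hUi, hUi']
    simp
  simp only [feedbackCost, Params.value, Params.gain]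
  rw [← hUdef, ← hV, key, hRU, hVt, hVd]
  simp only [valueParams, Matrix.transpose_sub, Matrix.transpose_mul, Matrix.mul_sub,
    Matrix.sub_mul, Matrix.mul_assoc]
  abel

lemma value_le_feedbackCost (hR : R.PosDef) {P : Matrix ι ι ℝ} (hP : 0 ≤ P) (K : Matrix κ ι ℝ) :
    (valueParams A B Q R P).value ≤ feedbackCost A B Q R P K := by
  rw [feedbackCost_eq hR hP]
  refine le_add_of_nonneg_right (transpose_mul_mul_nonneg ?_ _)
  exact nonneg_iff_posSemidef.2 (valueParams_uu_posDef hR hP).posSemidef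

lemma value_eq_feedbackCost (hR : R.PosDef) {P : Matrix ι ι ℝ} (hP : 0 ≤ P) :
    (valueParams A B Q R P).value
      = feedbackCost A B Q R P (valueParams A B Q R P).gain := by
  rw [feedbackCost_eq hR hP]; simp

lemma weight_le_value (hR : R.PosDef) {P : Matrix ι ι ℝ} (hP : 0 ≤ P) :
    Q ≤ (valueParams A B Q R P).value := by
  rw [value_eq_feedbackCost hR hP, feedbackCost]
  exact le_add_of_nonneg_left (add_nonneg (transpose_mul_mul_nonneg hP _)
    (transpose_mul_mul_nonneg (nonneg_iff_posSemidef.2 hR.posSemidef) _))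

/-- The Riccati map is monotone and concave; compared with the value at `0`, which is at least `Q`,
concavity along rays yields the gain `(1 - t) Q` that drives the contraction. -/
lemma smul_value_add_le_value (hR : R.PosDef) {P P' : Matrix ι ι ℝ} (hP : 0 ≤ P) (hP' : 0 ≤ P')
    {t : ℝ} (ht0 : 0 ≤ t) (ht1 : t ≤ 1) (h : t • P' ≤ P) :
    t • (valueParams A B Q R P').value + (1 - t) • Q ≤ (valueParams A B Q R P).value := by
  set K := (valueParams A B Q R P).gain with hK
  have hRK : 0 ≤ Kᵀ * R * K :=
    transpose_mul_mul_nonneg (nonneg_iff_posSemidef.2 hR.posSemidef) _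
  calc t • (valueParams A B Q R P').value + (1 - t) • Q
      ≤ t • feedbackCost A B Q R P' K + (1 - t) • Q := by
        gcongr
        exact value_le_feedbackCost hR hP' K
    _ = (A - B * K)ᵀ * (t • P') * (A - B * K) + t • (Kᵀ * R * K) + Q := by
        rw [feedbackCost, Matrix.mul_smul, Matrix.smul_mul]; module
    _ ≤ (A - B * K)ᵀ * P * (A - B * K) + (1 : ℝ) • (Kᵀ * R * K) + Q := by
        gcongr
        · exact transpose_mul_mul_le h _
    _ = (valueParams A B Q R P).value := by
        rw [value_eq_feedbackCost hR hP, ← hK, feedbackCost, one_smul]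

variable (A B Q R) in
/-- Value iteration: the iterates of the Riccati map. -/
noncomputable def riccatiIter (P0 : Matrix ι ι ℝ) : ℕ → Matrix ι ι ℝ
  | 0 => P0
  | j + 1 => (valueParams A B Q R (riccatiIter P0 j)).value

lemma riccatiIter_nonneg (hQ : 0 ≤ Q) (hR : R.PosDef) {P0 : Matrix ι ι ℝ} (hP0 : 0 ≤ P0) (j : ℕ) :
    0 ≤ riccatiIter A B Q R P0 j := by
  induction j with
  | zero => exact hP0
  | succ j ih => exact hQ.trans (weight_le_value hR ih)

variable [DecidableEq ι]

/-- A stabilizing feedback, held fixed, bounds the cost of all horizons. -/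
lemma exists_riccatiIter_le (hQ : Q.PosDef) (hR : R.PosDef) {P0 : Matrix ι ι ℝ} (hP0 : 0 ≤ P0)
    {K : Matrix κ ι ℝ} (hK : IsSchur (A - B * K)) :
    ∃ c : ℝ, 1 ≤ c ∧ ∀ j, riccatiIter A B Q R P0 j ≤ c • Q := by
  have hQ0 : 0 ≤ Q := nonneg_iff_posSemidef.2 hQ.posSemidef
  have hR0 : 0 ≤ R := nonneg_iff_posSemidef.2 hR.posSemidef
  obtain ⟨X, hX0, hX⟩ := hK.exists_lyapunov
    (add_nonneg (transpose_mul_mul_nonneg hR0 K) hQ0) hP0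
  have hPX : ∀ j, riccatiIter A B Q R P0 j ≤ X := by
    intro j
    induction j with
    | zero => exact hX0
    | succ j ih =>
      refine (value_le_feedbackCost hR (riccatiIter_nonneg hQ0 hR hP0 j) K).trans (le_trans ?_ hX)
      rw [feedbackCost, add_assoc]
      gcongr
      exact transpose_mul_mul_le ih _
  obtain ⟨c, hc, hcQ⟩ := exists_one_le_smul_of_posDef hQ
  have hXn : 0 ≤ X := hP0.trans hX0
  have hXt : 0 ≤ X.trace := (nonneg_iff_posSemidef.1 hXn).trace_nonneg
  refine ⟨max 1 (X.trace * c), le_max_left _ _, fun j => ?_⟩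
  calc riccatiIter A B Q R P0 j ≤ X := hPX j
    _ ≤ X.trace • 1 := le_trace_smul_one hXn
    _ ≤ X.trace • (c • Q) := smul_le_smul_of_nonneg_left hcQ hXt
    _ = (X.trace * c) • Q := by rw [smul_smul]
    _ ≤ max 1 (X.trace * c) • Q := smul_le_smul_of_nonneg_right (le_max_right _ _) hQ0

/-- One-sided contraction of value iteration in the Thompson metric. It starts from the trivial
inequality `0 ≤ P0`. -/
lemma smul_riccatiIter_succ_le (hQ : Q.PosDef) (hR : R.PosDef) {P0 : Matrix ι ι ℝ} (hP0 : 0 ≤ P0)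
    {c : ℝ} (hc : 1 ≤ c) (hle : ∀ j, riccatiIter A B Q R P0 j ≤ c • Q) (j : ℕ) :
    (1 - (1 - c⁻¹) ^ j) • riccatiIter A B Q R P0 (j + 1) ≤ riccatiIter A B Q R P0 j := by
  have hQ0 : 0 ≤ Q := nonneg_iff_posSemidef.2 hQ.posSemidef
  have hc0 : 0 < c := one_pos.trans_le hc
  have hn := fun j => riccatiIter_nonneg (A := A) (B := B) hQ0 hR hP0 j
  have hq0 : 0 ≤ 1 - c⁻¹ := sub_nonneg.2 (inv_le_one_of_one_le₀ hc)
  have hq1 : 1 - c⁻¹ ≤ 1 := by linarith [inv_pos.2 hc0]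
  induction j with
  | zero => simpa using hn 0
  | succ j ih =>
    set r := (1 - c⁻¹) ^ j with hr
    have hr0 : 0 ≤ r := pow_nonneg hq0 j
    have hr1 : r ≤ 1 := pow_le_one₀ hq0 hq1
    have h1 := smul_value_add_le_value (A := A) (B := B) (Q := Q) hR (hn j) (hn (j + 1))
      (sub_nonneg.2 hr1) (sub_le_self 1 hr0) ih
    refine le_trans ?_ h1
    change _ ≤ (1 - r) • riccatiIter A B Q R P0 (j + 2) + _
    have h2 : c⁻¹ • riccatiIter A B Q R P0 (j + 2) ≤ Q := by
      have := smul_le_smul_of_nonneg_left (hle (j + 2)) (inv_pos.2 hc0).le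
      rwa [smul_smul, inv_mul_cancel₀ hc0.ne', one_smul] at this
    have h3 := smul_le_smul_of_nonneg_left h2 hr0
    calc (1 - (1 - c⁻¹) ^ (j + 1)) • riccatiIter A B Q R P0 (j + 2)
        = (1 - r) • riccatiIter A B Q R P0 (j + 2)
          + r • c⁻¹ • riccatiIter A B Q R P0 (j + 2) := by
          rw [pow_succ, ← hr]; module
      _ ≤ (1 - r) • riccatiIter A B Q R P0 (j + 2) + (1 - (1 - r)) • Q := by
          rw [sub_sub_cancel]; gcongr

/-- Along value iteration the increments eventually drop below the weight `Q`. -/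
lemma exists_posDef_weight_sub_increment (hQ : Q.PosDef) (hR : R.PosDef) {P0 : Matrix ι ι ℝ}
    (hP0 : 0 ≤ P0) {K : Matrix κ ι ℝ} (hK : IsSchur (A - B * K)) :
    ∃ j, (Q - (riccatiIter A B Q R P0 (j + 1) - riccatiIter A B Q R P0 j)).PosDef := by
  have hQ0 : 0 ≤ Q := nonneg_iff_posSemidef.2 hQ.posSemidef
  obtain ⟨c, hc, hle⟩ := exists_riccatiIter_le hQ hR hP0 hK
  have hc0 : 0 < c := one_pos.trans_le hc
  have hq0 : 0 ≤ 1 - c⁻¹ := sub_nonneg.2 (inv_le_one_of_one_le₀ hc)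
  have hq1 : 1 - c⁻¹ < 1 := by linarith [inv_pos.2 hc0]
  -- With `(1 - 1/c) ^ j * c ≤ 1/2` the increment is at most `Q / 2`.
  obtain ⟨j, hj⟩ := exists_pow_lt_of_lt_one (show 0 < (2 * c)⁻¹ by positivity) hq1
  refine ⟨j, posDef_of_posDef_le (hQ.smul (show (0 : ℝ) < 1 / 2 by norm_num)) ?_⟩
  set r := (1 - c⁻¹) ^ j with hr
  have hr0 : 0 ≤ r := pow_nonneg hq0 j
  have hrc : r * c ≤ 1 / 2 := by
    have := mul_le_mul_of_nonneg_right hj.le hc0.le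
    rwa [mul_inv, mul_assoc, inv_mul_cancel₀ hc0.ne', mul_one, ← one_div] at this
  have h1 := smul_riccatiIter_succ_le hQ hR hP0 hc hle j
  rw [← hr, sub_smul, one_smul, sub_le_comm] at h1
  have h2 : riccatiIter A B Q R P0 (j + 1) - riccatiIter A B Q R P0 j ≤ (1 / 2 : ℝ) • Q := by
    refine h1.trans ((smul_le_smul_of_nonneg_left (hle (j + 1)) hr0).trans ?_)
    rw [smul_smul]
    exact smul_le_smul_of_nonneg_right hrc hQ0
  calc (1 / 2 : ℝ) • Q = Q - (1 / 2 : ℝ) • Q := by module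
    _ ≤ _ := by gcongr

end Riccati

/-! ### The data-based learning equation -/

section Regression

open scoped MatrixOrder

variable {ι κ : Type*}

lemma sum_sum_eq_sum_sym2 [Fintype ι] [DecidableEq ι] {M : Type*} [AddCommMonoid M]
    (g : ι → ι → M) (h : Sym2 ι → M) (hdiag : ∀ i, h s(i, i) = g i i)
    (hoff : ∀ i j, i ≠ j → h s(i, j) = g i j + g j i) : ∑ i, ∑ j, g i j = ∑ s, h s := by
  rw [← Fintype.sum_prod_type', ← Finset.sum_fiberwise Finset.univ (fun q : ι × ι => s(q.1, q.2))]
  refine Finset.sum_congr rfl fun s _ => ?_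
  induction s using Sym2.ind with
  | _ i j =>
    -- The fibre has one element on the diagonal and two elements off it.
    have hfib : (Finset.univ.filter fun q : ι × ι => s(q.1, q.2) = s(i, j))
        = {(i, j), (j, i)} := by
      ext ⟨a, b⟩; simp
    rw [hfib]
    by_cases hij : i = j
    · subst hij; simp [hdiag]
    · rw [Finset.sum_pair (by simp [hij]), hoff i j hij]

/-- The regressor `δ_v` evaluates the quadratic form of a half-vectorized matrix at `v`. -/
lemma delta_dotProduct_vech [Fintype ι] [DecidableEq ι] (v : ι → ℝ) (P : Matrix ι ι ℝ) :
    delta v ⬝ᵥ vech P = v ⬝ᵥ P *ᵥ v := by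
  have : v ⬝ᵥ P *ᵥ v = ∑ i, ∑ j, v i * (P i j * v j) := by
    simp only [dotProduct, mulVec, Finset.mul_sum]
  rw [this, dotProduct]
  refine (sum_sum_eq_sum_sym2 _ _ (fun i => ?_) fun i j hij => ?_).symm
  · simp only [delta, vech, Sym2.lift_mk, Matrix.sub_apply, Matrix.smul_apply, vecMulVec_apply,
      diagonal_pow, diagonal_apply_eq, Pi.pow_apply, smul_eq_mul]
    ring
  · simp only [delta, vech, Sym2.lift_mk, Matrix.sub_apply, Matrix.smul_apply, vecMulVec_apply,
      diagonal_pow, diagonal_apply_ne _ hij, diagonal_apply_ne _ hij.symm, smul_eq_mul]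
    ring

lemma phi_dotProduct_toVec [Fintype ι] [DecidableEq ι] [Fintype κ] [DecidableEq κ]
    (v : ι → ℝ) (w : κ → ℝ) (θ : Params ι κ) :
    phi v w ⬝ᵥ θ.toVec = v ⬝ᵥ θ.ηη *ᵥ v + 2 * (v ⬝ᵥ θ.ηu *ᵥ w) + w ⬝ᵥ θ.uu *ᵥ w := by
  have hmix : deltaMixed v w ⬝ᵥ Matrix.vec θ.ηu = v ⬝ᵥ θ.ηu *ᵥ w := by
    simp only [dotProduct, mulVec, Finset.mul_sum, deltaMixed, Matrix.vec, Fintype.sum_prod_type]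
    rw [Finset.sum_comm]
    exact Finset.sum_congr rfl fun i _ => Finset.sum_congr rfl fun j _ => by ring
  rw [phi, Params.toVec, sumElim_dotProduct_sumElim, sumElim_dotProduct_sumElim,
    smul_dotProduct, hmix, delta_dotProduct_vech, delta_dotProduct_vech, smul_eq_mul, add_assoc]

lemma vech_injOn_isSymm {P P' : Matrix ι ι ℝ} (hP : P.IsSymm) (hP' : P'.IsSymm)
    (h : vech P = vech P') : P = P' := by
  ext i j
  have h1 := congrFun h s(i, j)
  simp only [vech, Sym2.lift_mk] at h1
  rw [hP.apply i j, hP'.apply i j] at h1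
  linarith

lemma toVec_injOn_isSymm {θ θ' : Params ι κ} (h1 : θ.ηη.IsSymm) (h1' : θ'.ηη.IsSymm)
    (h2 : θ.uu.IsSymm) (h2' : θ'.uu.IsSymm) (h : θ.toVec = θ'.toVec) : θ = θ' := by
  obtain ⟨P, V, U⟩ := θ
  obtain ⟨P', V', U'⟩ := θ'
  have e1 : vech P = vech P' := funext fun s => congrFun h (Sum.inl s)
  have e2 : Matrix.vec V = Matrix.vec V' := funext fun s => congrFun h (Sum.inr (Sum.inl s))
  have e3 : vech U = vech U' := funext fun s => congrFun h (Sum.inr (Sum.inr s))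
  obtain rfl : P = P' := vech_injOn_isSymm h1 h1' e1
  obtain rfl : U = U' := vech_injOn_isSymm h2 h2' e3
  obtain rfl : V = V' := Matrix.vec_inj.1 e2
  rfl

lemma mulVec_injective_of_rank_eq_card {α β : Type*} [Fintype α] [Fintype β]
    {X : Matrix α β ℝ} (h : X.rank = Fintype.card β) : Function.Injective X.mulVec := by
  classical
  have h1 := X.mulVecLin.finrank_range_add_finrank_ker
  rw [Module.finrank_fintype_fun_eq_card, ← Matrix.rank, h] at h1
  have h2 : LinearMap.ker X.mulVecLin = ⊥ := Submodule.finrank_eq_zero.1 (by omega)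
  exact LinearMap.ker_eq_bot.1 h2

lemma card_paramIdx [Fintype ι] [Fintype κ] :
    Fintype.card (ParamIdx ι κ) = (Fintype.card ι + Fintype.card κ)
      * (Fintype.card ι + Fintype.card κ + 1) / 2 := by
  classical
  simp only [ParamIdx, Fintype.card_sum, Fintype.card_prod, Sym2.card]
  generalize Fintype.card ι = a
  generalize Fintype.card κ = b
  rw [Nat.choose_two_right, Nat.choose_two_right, Nat.add_sub_cancel, Nat.add_sub_cancel]
  obtain ⟨x, hx⟩ := (Nat.even_mul_succ_self a).two_dvd
  obtain ⟨y, hy⟩ := (Nat.even_mul_succ_self b).two_dvd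
  have e : (a + b) * (a + b + 1) = 2 * (x + (b * a + y)) := by
    linear_combination hx + hy
  rw [e, mul_comm (a + 1), mul_comm (b + 1), hx, hy]
  simp

variable [Fintype ι] [Fintype κ] [DecidableEq κ]

section

variable {A : Matrix ι ι ℝ} {B : Matrix ι κ ℝ} {Q : Matrix ι ι ℝ} {R : Matrix κ κ ℝ}

variable (A B Q R) in
/-- The run of the scheme predicted by the model. -/
noncomputable def modelRun (P0 : Matrix ι ι ℝ) (j : ℕ) : Iterate ι κ where
  P := riccatiIter A B Q R P0 j
  θ := valueParams A B Q R (riccatiIter A B Q R P0 j)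
  θaux := valueParams A B 0 R (riccatiIter A B Q R P0 j)

/-- Without the weight `Q` the auxiliary equation evaluates the same feedback, so the criterion
matrix is the increment of value iteration minus `Q`. -/
lemma bigH_modelRun (hQ : Q.PosDef) (hR : R.PosDef) {P0 : Matrix ι ι ℝ} (hP0 : P0.PosSemidef)
    (j : ℕ) : (modelRun A B Q R P0 j).bigH
      = riccatiIter A B Q R P0 (j + 1) - riccatiIter A B Q R P0 j - Q := by
  have hP := riccatiIter_nonneg (A := A) (B := B) hQ.posSemidef.nonneg hR hP0.nonneg j
  have hPD := valueParams_uu_posDef (A := A) (B := B) (Q := 0) hR hP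
  have hUs : (valueParams A B 0 R (riccatiIter A B Q R P0 j)).uuᵀ
      = (valueParams A B 0 R (riccatiIter A B Q R P0 j)).uu :=
    isSymm_of_nonneg hPD.posSemidef.nonneg
  have hUi := Matrix.mul_nonsing_inv _ hPD.det_pos.ne'.isUnit
  have hval : (valueParams A B Q R (riccatiIter A B Q R P0 j)).value
      = (valueParams A B 0 R (riccatiIter A B Q R P0 j)).value + Q := by
    simp only [Params.value, valueParams]; abel
  change _ = (valueParams A B Q R (riccatiIter A B Q R P0 j)).value - _ - _
  rw [hval]
  simp only [Iterate.bigH, modelRun, Params.value, Params.gain]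
  generalize valueParams A B 0 R (riccatiIter A B Q R P0 j) = θ at *
  have hsq : (θ.uu⁻¹ * θ.ηuᵀ)ᵀ * θ.uu * (θ.uu⁻¹ * θ.ηuᵀ) = θ.ηu * (θ.uu⁻¹ * θ.ηuᵀ) := by
    rw [Matrix.mul_assoc, ← Matrix.mul_assoc θ.uu, hUi, Matrix.one_mul, Matrix.transpose_mul,
      Matrix.transpose_transpose, Matrix.transpose_nonsing_inv, hUs, Matrix.mul_assoc]
  rw [hsq, Matrix.mul_assoc]
  module

end

variable [DecidableEq ι] {η : ℕ → ι → ℝ} {u : ℕ → κ → ℝ} {kN : ℕ}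

lemma SolvesLearning.unique
    (hPi : (regPi η u kN).rank = Fintype.card (ParamIdx ι κ)) {c : ℕ → ℝ} {P : Matrix ι ι ℝ}
    {θ θ' : Params ι κ} (h : SolvesLearning η u kN c P θ) (h' : SolvesLearning η u kN c P θ') :
    θ = θ' :=
  toVec_injOn_isSymm h.1 h'.1 h.2.1 h'.2.1
    (mulVec_injective_of_rank_eq_card hPi (h.2.2.trans h'.2.2.symm))

variable {A : Matrix ι ι ℝ} {B : Matrix ι κ ℝ} {Q : Matrix ι ι ℝ} {R : Matrix κ κ ℝ}

/-- Along data of the linear system `η⁺ = A η + B u` with quadratic utility, the model-based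
parameters solve the data-based learning equation. -/
lemma solvesLearning_valueParams (hη : ∀ k, η (k + 1) = A *ᵥ η k + B *ᵥ u k) {c : ℕ → ℝ}
    (hc : ∀ k, c k = η k ⬝ᵥ Q *ᵥ η k + u k ⬝ᵥ R *ᵥ u k) (hQ : Q.IsSymm) (hR : R.IsSymm)
    {P : Matrix ι ι ℝ} (hP : P.IsSymm) :
    SolvesLearning η u kN c P (valueParams A B Q R P) := by
  refine ⟨?_, ?_, ?_⟩
  · simp [IsSymm, valueParams, Matrix.transpose_mul, hP.eq, hQ.eq, Matrix.mul_assoc]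
  · simp [IsSymm, valueParams, Matrix.transpose_mul, hP.eq, hR.eq, Matrix.mul_assoc]
  · funext k
    change phi (η k) (u k) ⬝ᵥ _ = delta (η (k + 1)) ⬝ᵥ vech P + c k
    rw [phi_dotProduct_toVec, delta_dotProduct_vech, hη, hc]
    have hcross : (P *ᵥ A *ᵥ η k) ⬝ᵥ (B *ᵥ u k) = (A *ᵥ η k) ⬝ᵥ P *ᵥ B *ᵥ u k := by
      rw [dotProduct_comm, ← dotProduct_transpose_mulVec, hP.eq]
    simp only [valueParams, Matrix.add_mulVec, ← Matrix.mulVec_mulVec, dotProduct_add,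
      add_dotProduct, Matrix.mulVec_add, dotProduct_transpose_mulVec,
      dotProduct_comm (B *ᵥ u k) (P *ᵥ _), dotProduct_comm (A *ᵥ η k) (P *ᵥ A *ᵥ _), hcross,
      dotProduct_comm (P *ᵥ B *ᵥ u k) (A *ᵥ _)]
    ring

lemma isVIRun_modelRun (hη : ∀ k, η (k + 1) = A *ᵥ η k + B *ᵥ u k) {c caux : ℕ → ℝ}
    (hc : ∀ k, c k = η k ⬝ᵥ Q *ᵥ η k + u k ⬝ᵥ R *ᵥ u k) (hcaux : ∀ k, caux k = u k ⬝ᵥ R *ᵥ u k)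
    (hQ : Q.PosDef) (hR : R.PosDef) {P0 : Matrix ι ι ℝ} (hP0 : P0.PosSemidef) :
    IsVIRun η u kN c caux P0 (modelRun A B Q R P0) where
  init := rfl
  solves j := solvesLearning_valueParams hη hc (isSymm_of_nonneg hQ.posSemidef.nonneg)
    (isSymm_of_nonneg hR.posSemidef.nonneg)
    (isSymm_of_nonneg (riccatiIter_nonneg hQ.posSemidef.nonneg hR hP0.nonneg j))
  update j := rfl
  solves_aux j := solvesLearning_valueParams hη (by simpa using hcaux) Matrix.isSymm_zero
    (isSymm_of_nonneg hR.posSemidef.nonneg)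
    (isSymm_of_nonneg (riccatiIter_nonneg hQ.posSemidef.nonneg hR hP0.nonneg j))

/-- The learning equations determine both parameter triples from `P_j`, hence the whole run. -/
lemma IsVIRun.unique (hPi : (regPi η u kN).rank = Fintype.card (ParamIdx ι κ)) {c caux : ℕ → ℝ}
    {P0 : Matrix ι ι ℝ} {s s' : ℕ → Iterate ι κ} (h : IsVIRun η u kN c caux P0 s)
    (h' : IsVIRun η u kN c caux P0 s') : s = s' := by
  have hθ : ∀ j, (s j).P = (s' j).P → s j = s' j := fun j hj => by
    have e1 := (h.solves j).unique hPi (hj ▸ h'.solves j)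
    have e2 := (h.solves_aux j).unique hPi (hj ▸ h'.solves_aux j)
    cases hs : s j
    cases hs' : s' j
    simp_all
  funext j
  refine hθ j ?_
  induction j with
  | zero => rw [h.init, h'.init]
  | succ j ih => rw [h.update, h'.update, hθ j ih]

end Regression

/-! ### Stability of block diagonal systems and cascades -/

section Eigenvectors

variable {ι κ : Type*} [Fintype ι] [Fintype κ] [DecidableEq κ]

lemma isSchur_iff_eigenvector {F : Matrix κ κ ℝ} :
    IsSchur F ↔ ∀ (z : ℂ) (w : κ → ℂ), 1 ≤ ‖z‖ → F.map (algebraMap ℝ ℂ) *ᵥ w = z • w → w = 0 := by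
  have key : ∀ z : ℂ, z ∈ spectrum ℂ (F.map (algebraMap ℝ ℂ)) ↔
      ∃ w, w ≠ 0 ∧ F.map (algebraMap ℝ ℂ) *ᵥ w = z • w := fun z => by
    rw [spectrum.mem_iff, Matrix.isUnit_iff_isUnit_det, isUnit_iff_ne_zero, not_not,
      ← exists_mulVec_eq_zero_iff]
    refine exists_congr fun w => and_congr_right fun _ => ?_
    rw [Matrix.sub_mulVec, sub_eq_zero, Algebra.algebraMap_eq_smul_one, Matrix.smul_mulVec,
      Matrix.one_mulVec, eq_comm]
  constructor
  · intro h z w hz hw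
    by_contra hw0
    exact absurd (h z ((key z).2 ⟨w, hw0, hw⟩)) hz.not_gt
  · intro h z hz
    obtain ⟨w, hw0, hw⟩ := (key z).1 hz
    exact lt_of_not_ge fun hz1 => hw0 (h z w hz1 hw)

/-- If `T` intertwines `F` with a Schur matrix, every unstable eigenvector of `F` is in the kernel
of `T`. -/
lemma IsSchur.mulVec_eq_zero_of_intertwine {F : Matrix ι ι ℝ} {H : Matrix κ κ ℝ} (hH : IsSchur H)
    {T : Matrix κ ι ℝ} (hT : T * F = H * T) {z : ℂ} (hz : 1 ≤ ‖z‖) {w : ι → ℂ}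
    (hw : F.map (algebraMap ℝ ℂ) *ᵥ w = z • w) : T.map (algebraMap ℝ ℂ) *ᵥ w = 0 := by
  refine isSchur_iff_eigenvector.1 hH z _ hz ?_
  rw [Matrix.mulVec_mulVec, ← Matrix.map_mul, ← hT, Matrix.map_mul, ← Matrix.mulVec_mulVec, hw,
    Matrix.mulVec_smul]

variable [DecidableEq ι]

lemma IsSchur.of_charpoly_eq {F G : Matrix ι ι ℝ} (hG : IsSchur G)
    (h : F.charpoly = G.charpoly) : IsSchur F := by
  intro z hz
  refine hG z ?_
  rw [mem_spectrum_iff_isRoot_charpoly, charpoly_map] at hz ⊢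
  rwa [← h]

lemma IsSchur.of_intertwine {F G T : Matrix ι ι ℝ} (hG : IsSchur G) (hTF : T * F = G * T)
    (hT : IsUnit T.det) : IsSchur F := by
  refine isSchur_iff_eigenvector.2 fun z w hz hw => ?_
  have h := hG.mulVec_eq_zero_of_intertwine hTF hz hw
  have h1 : (T⁻¹).map (algebraMap ℝ ℂ) *ᵥ T.map (algebraMap ℝ ℂ) *ᵥ w = w := by
    rw [Matrix.mulVec_mulVec, ← Matrix.map_mul, Matrix.nonsing_inv_mul _ hT]
    simp
  rw [← h1, h, Matrix.mulVec_zero]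

/-- Stability of a cascade: the subsystem `M η` evolves autonomously, and drives `G`. -/
lemma IsSchur.of_cascade {F G : Matrix ι ι ℝ} {H : Matrix κ κ ℝ} {M : Matrix κ ι ℝ}
    {W : Matrix ι κ ℝ} (hG : IsSchur G) (hH : IsSchur H) (hF : F = G + W * M)
    (hMF : M * F = H * M) : IsSchur F := by
  refine isSchur_iff_eigenvector.2 fun z w hz hw => ?_
  have h := hH.mulVec_eq_zero_of_intertwine hMF hz hw
  refine isSchur_iff_eigenvector.1 hG z w hz ?_
  rw [← hw, hF, Matrix.map_add _ (map_add _), Matrix.map_mul, Matrix.add_mulVec,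
    ← Matrix.mulVec_mulVec, h, Matrix.mulVec_zero, add_zero]

lemma IsSchur.fromBlocks {F : Matrix ι ι ℝ} {G : Matrix κ κ ℝ} (hF : IsSchur F)
    (hG : IsSchur G) : IsSchur (Matrix.fromBlocks F 0 0 G) := by
  refine isSchur_iff_eigenvector.2 fun z w hz hw => ?_
  rw [Matrix.fromBlocks_map, Matrix.fromBlocks_mulVec] at hw
  have h1 := congrArg (· ∘ Sum.inl) hw
  have h2 := congrArg (· ∘ Sum.inr) hw
  have h1' : F.map (algebraMap ℝ ℂ) *ᵥ (w ∘ Sum.inl) = z • (w ∘ Sum.inl) := by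
    simpa [Pi.smul_comp] using h1
  have h2' : G.map (algebraMap ℝ ℂ) *ᵥ (w ∘ Sum.inr) = z • (w ∘ Sum.inr) := by
    simpa [Pi.smul_comp] using h2
  have e1 := isSchur_iff_eigenvector.1 hF z (w ∘ Sum.inl) hz h1'
  have e2 := isSchur_iff_eigenvector.1 hG z (w ∘ Sum.inr) hz h2'
  rw [← Sum.elim_comp_inl_inr w, e1, e2]
  exact Sum.elim_zero_zero

lemma IsSchur.one_kronecker {F : Matrix ι ι ℝ} (hF : IsSchur F) :
    IsSchur ((1 : Matrix κ κ ℝ) ⊗ₖ F) := by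
  refine isSchur_iff_eigenvector.2 fun z w hz hw => ?_
  ext ⟨i, j⟩
  refine congrFun (isSchur_iff_eigenvector.1 hF z (fun c => w (i, c)) hz (funext fun j => ?_)) j
  have h := congrFun hw (i, j)
  simpa [Matrix.mulVec, dotProduct, Fintype.sum_prod_type_right, Matrix.one_apply,
    apply_ite Complex.ofReal, ite_mul] using h

end Eigenvectors

/-! ### Coefficients of the adjugate of the characteristic matrix -/

section Resolvent

variable {n : ℕ}

/-- The coefficient of `z ^ c` in the matrix polynomial `adj(z I - F)`. -/
noncomputable def resolventCoeff (F : Matrix (Fin n) (Fin n) ℝ) (c : ℕ) :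
    Matrix (Fin n) (Fin n) ℝ :=
  F.charmatrix.adjugate.map fun q => q.coeff c

lemma adjCoeff_apply (F : Matrix (Fin n) (Fin n) ℝ) (v : Fin n → ℝ) (a c : Fin n) :
    adjCoeff F v a c = (resolventCoeff F c *ᵥ v) a := rfl

lemma coeff_matPolyEquiv_adjugate (F : Matrix (Fin n) (Fin n) ℝ) (c : ℕ) :
    (matPolyEquiv F.charmatrix.adjugate).coeff c = resolventCoeff F c := by
  ext i j
  rw [matPolyEquiv_coeff_apply]; rfl

lemma X_sub_C_mul_adjugate (F : Matrix (Fin n) (Fin n) ℝ) :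
    (Polynomial.X - Polynomial.C F) * matPolyEquiv F.charmatrix.adjugate
      = F.charpoly.map (algebraMap ℝ (Matrix (Fin n) (Fin n) ℝ)) := by
  rw [← matPolyEquiv_charmatrix, ← map_mul, Matrix.mul_adjugate, ← matPolyEquiv_smul_one]
  rfl

lemma mul_resolventCoeff_zero (F : Matrix (Fin n) (Fin n) ℝ) :
    F * resolventCoeff F 0 = -(F.charpoly.coeff 0 • 1) := by
  have h := congrArg (fun q => Polynomial.coeff q 0) (X_sub_C_mul_adjugate F)
  simp only [sub_mul, Polynomial.coeff_sub, Polynomial.coeff_map,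
    Polynomial.mul_coeff_zero, Polynomial.coeff_X_zero, zero_mul, zero_sub,
    Polynomial.coeff_C_zero, coeff_matPolyEquiv_adjugate, Algebra.algebraMap_eq_smul_one] at h
  rw [← h, neg_neg]

lemma mul_resolventCoeff_succ (F : Matrix (Fin n) (Fin n) ℝ) (c : ℕ) :
    F * resolventCoeff F (c + 1) = resolventCoeff F c - F.charpoly.coeff (c + 1) • 1 := by
  have h := congrArg (fun q => Polynomial.coeff q (c + 1)) (X_sub_C_mul_adjugate F)
  simp only [sub_mul, Polynomial.coeff_sub, Polynomial.coeff_C_mul, Polynomial.coeff_map,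
    Polynomial.coeff_X_mul, coeff_matPolyEquiv_adjugate, Algebra.algebraMap_eq_smul_one] at h
  rw [← h, sub_sub_cancel]

lemma resolventCoeff_eq_zero (F : Matrix (Fin n) (Fin n) ℝ) {c : ℕ} (hc : n ≤ c) :
    resolventCoeff F c = 0 := by
  -- Above degree `n` the recursion is `N_c = F N_{c+1}`, and the coefficients vanish eventually.
  have hstep : ∀ k, resolventCoeff F c = F ^ k * resolventCoeff F (c + k) := by
    intro k
    induction k with
    | zero => simp
    | succ k ih =>
      have h0 : F.charpoly.coeff (c + k + 1) = 0 := by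
        refine Polynomial.coeff_eq_zero_of_natDegree_lt ?_
        rw [Matrix.charpoly_natDegree_eq_dim, Fintype.card_fin]; omega
      rw [ih, pow_succ, Matrix.mul_assoc, ← add_assoc, mul_resolventCoeff_succ, h0, zero_smul,
        sub_zero]
  rw [hstep ((matPolyEquiv F.charmatrix.adjugate).natDegree + 1), ← coeff_matPolyEquiv_adjugate,
    Polynomial.coeff_eq_zero_of_natDegree_lt (by omega), Matrix.mul_zero]

lemma resolventCoeff_last (F : Matrix (Fin n) (Fin n) ℝ) {c : ℕ} (hc : c + 1 = n) :
    resolventCoeff F c = 1 := by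
  have h := mul_resolventCoeff_succ F c
  have h1 : F.charpoly.coeff (c + 1) = 1 := by
    have hdeg : F.charpoly.natDegree = c + 1 := by
      rw [Matrix.charpoly_natDegree_eq_dim, Fintype.card_fin, hc]
    rw [← hdeg, F.charpoly_monic.coeff_natDegree]
  rw [resolventCoeff_eq_zero F hc.ge, Matrix.mul_zero, h1, one_smul, eq_comm, sub_eq_zero] at h
  exact h

lemma adjCoeff_mulVec_lastVec (F : Matrix (Fin n) (Fin n) ℝ) (v : Fin n → ℝ) :
    adjCoeff F v *ᵥ lastVec n = v := by
  cases n with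
  | zero => exact Subsingleton.elim _ _
  | succ k =>
    ext a
    rw [Matrix.mulVec, dotProduct, Finset.sum_eq_single (Fin.last k)]
    · rw [adjCoeff_apply, resolventCoeff_last F (by simp)]
      simp [lastVec]
    · intro c _ hc
      have : (c : ℕ) ≠ k := fun h => hc (Fin.ext h)
      simp [lastVec, this]
    · simp

/-- The coefficient matrix of `adj(z I - F) v` intertwines `F` with the companion matrix of its
characteristic polynomial. -/
lemma adjCoeff_mul_companion {F AL : Matrix (Fin n) (Fin n) ℝ} (h : F.charpoly = AL.charpoly)
    (v : Fin n → ℝ) : adjCoeff F v * companion AL = F * adjCoeff F v := by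
  have hcol : ∀ a c, (F * adjCoeff F v) a c = ((F * resolventCoeff F c) *ᵥ v) a := fun a c => by
    rw [← Matrix.mulVec_mulVec]; rfl
  have hcomp : ∀ i j : Fin n, companion AL i j = lastVec n i * -(AL.charpoly.coeff j)
      + if (j : ℕ) = (i : ℕ) + 1 then 1 else 0 := fun i j => by
    have := j.isLt
    by_cases hi : (i : ℕ) + 1 = n
    · simp [companion, lastVec, hi, this.ne]
    · simp [companion, lastVec, hi]
  ext a j
  rw [hcol, Matrix.mul_apply]
  simp only [hcomp, mul_add, Finset.sum_add_distrib, ← mul_assoc, ← Finset.sum_mul]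
  have hlast : ∑ i, adjCoeff F v a i * lastVec n i = v a :=
    congrFun (adjCoeff_mulVec_lastVec F v) a
  rw [hlast, ← h]
  obtain ⟨j, hj⟩ := j
  cases j with
  | zero =>
    rw [mul_resolventCoeff_zero]
    simp [Matrix.neg_mulVec, Matrix.smul_mulVec, mul_comm]
  | succ j =>
    rw [mul_resolventCoeff_succ, Finset.sum_eq_single ⟨j, by omega⟩]
    · simp [Matrix.sub_mulVec, Matrix.smul_mulVec, adjCoeff_apply]; ring
    · intro i _ hi
      have : j ≠ (i : ℕ) := fun h => hi (Fin.ext h.symm)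
      simp [this]
    · simp

end Resolvent

/-! ### The internal model -/

section InternalModel

variable {n m p : ℕ}

/-- The input matrix `block diag [b, …, b]` of the input part of the internal model. -/
noncomputable def inputMatrix (n m p : ℕ) : Matrix (EtaIdx n m p) (Fin m) ℝ :=
  (gTwo n m p).toCols₁

/-- The matrix through which the output drives the internal model. -/
noncomputable def outputMatrix (n m p : ℕ) : Matrix (EtaIdx n m p) (Fin p) ℝ :=
  (gTwo n m p).toCols₂.toCols₁

lemma gTwo_mulVec_zeta (u : Fin m → ℝ) (y : Fin p → ℝ) :
    gTwo n m p *ᵥ zeta u y = inputMatrix n m p *ᵥ u + outputMatrix n m p *ᵥ y := by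
  rw [zeta, ← Matrix.fromCols_toCols (gTwo n m p), Matrix.fromCols_mulVec_sumElim,
    ← Matrix.fromCols_toCols (gTwo n m p).toCols₂, Matrix.fromCols_mulVec_sumElim,
    Matrix.mulVec_zero, add_zero]
  rfl

lemma inputMatrix_eq : inputMatrix n m p = fromRows (bBlocks n m) 0 := by
  ext (i | i) j <;> rfl

lemma outputMatrix_eq :
    outputMatrix n m p = fromRows 0 (fromRows (bBlocks n p) 0) := by
  ext (i | i | i) j <;> rfl

/-- The row of coefficient matrices `[N(F, W_1), …, N(F, W_q)]` of the columns of `W`. -/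
noncomputable def adjCoeffCols {q : ℕ} (F : Matrix (Fin n) (Fin n) ℝ)
    (W : Matrix (Fin n) (Fin q) ℝ) : Matrix (Fin n) (Fin q × Fin n) ℝ :=
  Matrix.of fun a ic => adjCoeff F (fun r => W r ic.1) a ic.2

lemma adjCoeffCols_mul_kronecker {q : ℕ} (F : Matrix (Fin n) (Fin n) ℝ)
    (W : Matrix (Fin n) (Fin q) ℝ) :
    adjCoeffCols F W * ((1 : Matrix (Fin q) (Fin q) ℝ) ⊗ₖ companion F) = F * adjCoeffCols F W := by
  ext a ⟨i, j⟩
  have h := congrFun (congrFun (adjCoeff_mul_companion (rfl : F.charpoly = _)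
    (fun r => W r i)) a) j
  simpa [Matrix.mul_apply, adjCoeffCols, Fintype.sum_prod_type_right, Matrix.one_apply] using h

lemma adjCoeffCols_mul_bBlocks {q : ℕ} (F : Matrix (Fin n) (Fin n) ℝ)
    (W : Matrix (Fin n) (Fin q) ℝ) : adjCoeffCols F W * bBlocks n q = W := by
  ext a i
  have h := congrFun (adjCoeff_mulVec_lastVec F (fun r => W r i)) a
  simpa [Matrix.mul_apply, adjCoeffCols, bBlocks, Fintype.sum_prod_type_right, Matrix.mulVec,
    dotProduct] using h

variable {A : Matrix (Fin n) (Fin n) ℝ} {B : Matrix (Fin n) (Fin m) ℝ}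
  {C : Matrix (Fin p) (Fin n) ℝ} {L : Matrix (Fin n) (Fin p) ℝ} {Aε : Matrix (Fin n) (Fin n) ℝ}
  {x0 ηε0 : Fin n → ℝ}

lemma paramMatrix_eq : paramMatrix A B C L Aε x0 ηε0 = fromCols (adjCoeffCols (A - L * C) B)
    (fromCols (adjCoeffCols (A - L * C) L) (errMatrix (A - L * C) Aε x0 ηε0)) := rfl

lemma errMatrix_mul {AL : Matrix (Fin n) (Fin n) ℝ} (hAε : Aε.charpoly = AL.charpoly)
    (hηε0 : IsUnit (adjCoeff Aε ηε0).det) :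
    errMatrix AL Aε x0 ηε0 * Aε = AL * errMatrix AL Aε x0 ηε0 := by
  have h1 : (adjCoeff Aε ηε0)⁻¹ * Aε = companion AL * (adjCoeff Aε ηε0)⁻¹ := by
    calc (adjCoeff Aε ηε0)⁻¹ * Aε
        = (adjCoeff Aε ηε0)⁻¹ * (Aε * adjCoeff Aε ηε0) * (adjCoeff Aε ηε0)⁻¹ := by
          rw [Matrix.mul_assoc, Matrix.mul_assoc, Matrix.mul_nonsing_inv _ hηε0, Matrix.mul_one]
      _ = _ := by
          rw [← adjCoeff_mul_companion hAε, ← Matrix.mul_assoc, Matrix.nonsing_inv_mul _ hηε0,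
            Matrix.one_mul]
  rw [errMatrix, Matrix.mul_assoc, h1, ← Matrix.mul_assoc, adjCoeff_mul_companion rfl,
    Matrix.mul_assoc]

lemma errMatrix_mulVec {AL : Matrix (Fin n) (Fin n) ℝ} (hηε0 : IsUnit (adjCoeff Aε ηε0).det) :
    errMatrix AL Aε x0 ηε0 *ᵥ ηε0 = x0 := by
  have h1 : (adjCoeff Aε ηε0)⁻¹ *ᵥ ηε0 = lastVec n := by
    calc (adjCoeff Aε ηε0)⁻¹ *ᵥ ηε0
        = (adjCoeff Aε ηε0)⁻¹ *ᵥ (adjCoeff Aε ηε0 *ᵥ lastVec n) := by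
          rw [adjCoeff_mulVec_lastVec]
      _ = lastVec n := by
          rw [Matrix.mulVec_mulVec, Matrix.nonsing_inv_mul _ hηε0, Matrix.one_mulVec]
  rw [errMatrix, ← Matrix.mulVec_mulVec, h1, adjCoeff_mulVec_lastVec]

lemma paramMatrix_mul_gOne (hAε : Aε.charpoly = (A - L * C).charpoly)
    (hηε0 : IsUnit (adjCoeff Aε ηε0).det) :
    paramMatrix A B C L Aε x0 ηε0 * gOne m p (A - L * C) Aε
      = (A - L * C) * paramMatrix A B C L Aε x0 ηε0 := by
  rw [paramMatrix_eq, gOne, fromCols_mul_fromBlocks, fromCols_mul_fromBlocks]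
  simp only [Matrix.mul_zero, add_zero, zero_add, mul_fromCols, adjCoeffCols_mul_kronecker,
    errMatrix_mul hAε hηε0]

lemma paramMatrix_mul_inputMatrix :
    paramMatrix A B C L Aε x0 ηε0 * inputMatrix n m p = B := by
  rw [paramMatrix_eq, inputMatrix_eq, fromCols_mul_fromRows, adjCoeffCols_mul_bBlocks,
    Matrix.mul_zero, add_zero]

lemma paramMatrix_mul_outputMatrix :
    paramMatrix A B C L Aε x0 ηε0 * outputMatrix n m p = L := by
  rw [paramMatrix_eq, outputMatrix_eq, fromCols_mul_fromRows, fromCols_mul_fromRows,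
    adjCoeffCols_mul_bBlocks, Matrix.mul_zero, Matrix.mul_zero, add_zero, zero_add]

lemma paramMatrix_mulVec_etaInit (hηε0 : IsUnit (adjCoeff Aε ηε0).det) :
    paramMatrix A B C L Aε x0 ηε0 *ᵥ etaInit m p ηε0 = x0 := by
  rw [paramMatrix_eq, etaInit, fromCols_mulVec_sumElim, fromCols_mulVec_sumElim,
    errMatrix_mulVec hηε0, Matrix.mulVec_zero, Matrix.mulVec_zero, zero_add, zero_add]

/-- The internal state reproduces the plant state: `x = M η`. -/
lemma state_eq_paramMatrix_mulVec (hAε : Aε.charpoly = (A - L * C).charpoly)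
    (hηε0 : IsUnit (adjCoeff Aε ηε0).det)
    {u : ℕ → Fin m → ℝ} {x : ℕ → Fin n → ℝ} {y : ℕ → Fin p → ℝ} {η : ℕ → EtaIdx n m p → ℝ}
    (hx : ∀ k, x (k + 1) = A *ᵥ x k + B *ᵥ u k) (hy : ∀ k, y k = C *ᵥ x k)
    (hη_init : η 0 = etaInit m p ηε0)
    (hη : ∀ k, η (k + 1) = gOne m p (A - L * C) Aε *ᵥ η k + gTwo n m p *ᵥ zeta (u k) (y k))
    (k : ℕ) : x k = paramMatrix A B C L Aε (x 0) ηε0 *ᵥ η k := by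
  induction k with
  | zero => rw [hη_init, paramMatrix_mulVec_etaInit hηε0]
  | succ k ih =>
    rw [hη, hx, gTwo_mulVec_zeta, Matrix.mulVec_add, Matrix.mulVec_add, Matrix.mulVec_mulVec,
      Matrix.mulVec_mulVec, Matrix.mulVec_mulVec, paramMatrix_mul_gOne hAε hηε0,
      paramMatrix_mul_inputMatrix, paramMatrix_mul_outputMatrix, ← Matrix.mulVec_mulVec, ← ih, hy,
      Matrix.sub_mulVec, ← Matrix.mulVec_mulVec]
    abel

lemma isSchur_gOne (hL : IsSchur (A - L * C)) (hAε : Aε.charpoly = (A - L * C).charpoly)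
    (hηε0 : IsUnit (adjCoeff Aε ηε0).det) : IsSchur (gOne m p (A - L * C) Aε) := by
  have hε : IsSchur Aε := hL.of_charpoly_eq hAε
  have hc : IsSchur (companion (A - L * C)) :=
    hε.of_intertwine (adjCoeff_mul_companion hAε ηε0) hηε0
  exact hc.one_kronecker.fromBlocks (hc.one_kronecker.fromBlocks hε)

/-- The state matrix of the internal model once the output is expressed as `y = C M η`. -/
noncomputable def augmentedMatrix (A : Matrix (Fin n) (Fin n) ℝ) (C : Matrix (Fin p) (Fin n) ℝ)
    (L : Matrix (Fin n) (Fin p) ℝ) (Aε : Matrix (Fin n) (Fin n) ℝ)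
    (M : Matrix (Fin n) (EtaIdx n m p) ℝ) : Matrix (EtaIdx n m p) (EtaIdx n m p) ℝ :=
  gOne m p (A - L * C) Aε + outputMatrix n m p * C * M

/-- A stabilizing feedback `u = -K x` of the plant, implemented as `u = -K M η`, stabilizes the
internal model. -/
lemma isSchur_augmentedMatrix_sub (hL : IsSchur (A - L * C))
    (hAε : Aε.charpoly = (A - L * C).charpoly) (hηε0 : IsUnit (adjCoeff Aε ηε0).det)
    {K : Matrix (Fin m) (Fin n) ℝ} (hK : IsSchur (A - B * K))
    {M : Matrix (Fin n) (EtaIdx n m p) ℝ} (hM : M = paramMatrix A B C L Aε x0 ηε0) :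
    IsSchur (augmentedMatrix A C L Aε M - inputMatrix n m p * (K * M)) := by
  refine (isSchur_gOne hL hAε hηε0).of_cascade hK (M := M)
    (W := outputMatrix n m p * C - inputMatrix n m p * K) ?_ ?_
  · rw [augmentedMatrix, Matrix.sub_mul, Matrix.mul_assoc (inputMatrix n m p)]; abel
  · have h1 : M * gOne m p (A - L * C) Aε = (A - L * C) * M := by
      rw [hM, paramMatrix_mul_gOne hAε hηε0]
    have h2 : M * inputMatrix n m p = B := by rw [hM, paramMatrix_mul_inputMatrix]
    have h3 : M * outputMatrix n m p = L := by rw [hM, paramMatrix_mul_outputMatrix]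
    rw [augmentedMatrix, Matrix.mul_sub, Matrix.mul_add, h1, Matrix.mul_assoc (outputMatrix n m p),
      ← Matrix.mul_assoc M, h3, ← Matrix.mul_assoc M, h2]
    simp only [Matrix.sub_mul, Matrix.mul_assoc]
    abel

end InternalModel

end ModelFreeVI

theorem lemma3 (n m p : ℕ)
    (A : Matrix (Fin n) (Fin n) ℝ) (B : Matrix (Fin n) (Fin m) ℝ) (C : Matrix (Fin p) (Fin n) ℝ)
    (hAB : Stabilizable A B)
    (Qy : Matrix (Fin p) (Fin p) ℝ) (hQy : Qy.PosSemidef)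
    (R : Matrix (Fin m) (Fin m) ℝ) (hR : R.PosDef)
    -- the observer gain and the internal model
    (L : Matrix (Fin n) (Fin p) ℝ) (hL : IsSchur (A - L * C))
    (Aε : Matrix (Fin n) (Fin n) ℝ) (hAε : Aε.charpoly = (A - L * C).charpoly)
    (ηε0 : Fin n → ℝ) (hηε0 : IsUnit (adjCoeff Aε ηε0).det)
    -- the collected data, for an arbitrary input sequence
    (u : ℕ → Fin m → ℝ) (x : ℕ → Fin n → ℝ) (y : ℕ → Fin p → ℝ) (η : ℕ → EtaIdx n m p → ℝ)
    (hx : ∀ k, x (k + 1) = A *ᵥ x k + B *ᵥ u k)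
    (hy : ∀ k, y k = C *ᵥ x k)
    (hη_init : η 0 = etaInit m p ηε0)
    (hη : ∀ k, η (k + 1) = gOne m p (A - L * C) Aε *ᵥ η k + gTwo n m p *ᵥ zeta (u k) (y k))
    -- the two rank conditions
    (kN : ℕ)
    (hPi : (regPi η u kN).rank
      = (n * (m + p + 1) + m) * (n * (m + p + 1) + m + 1) / 2)
    (hM : (paramMatrix A B C L Aε (x 0) ηε0).rank = n)
    -- the modified weight and the initial value matrix
    (Qε : Matrix (EtaIdx n m p) (EtaIdx n m p) ℝ) (hQε : Qε.PosDef)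
    (P0 : Matrix (EtaIdx n m p) (EtaIdx n m p) ℝ) (hP0 : P0.PosSemidef) :
    ∃ s : ℕ → Iterate (EtaIdx n m p) (Fin m),
      IsVIRun η u kN (modifiedUtility Qε Qy R η y u) (inputUtility R u) P0 s ∧
      (∀ s', IsVIRun η u kN (modifiedUtility Qε Qy R η y u) (inputUtility R u) P0 s' → s' = s) ∧
      ∃ j, NegDef (s j).calH := by
  obtain ⟨K, hK⟩ := hAB
  set M := paramMatrix A B C L Aε (x 0) ηε0 with hMdef
  have hxM : ∀ k, x k = M *ᵥ η k :=
    state_eq_paramMatrix_mulVec hAε hηε0 hx hy hη_init hη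
  set Q := Qε + (C * M)ᵀ * Qy * (C * M) with hQdef
  have hQ : Q.PosDef := hQε.add_posSemidef (hQy.conjTranspose_mul_mul_same (C * M))
  have hlin : ∀ k, η (k + 1)
      = augmentedMatrix A C L Aε M *ᵥ η k + inputMatrix n m p *ᵥ u k := fun k => by
    rw [hη, gTwo_mulVec_zeta, hy, hxM, augmentedMatrix, Matrix.add_mulVec,
      ← Matrix.mulVec_mulVec, ← Matrix.mulVec_mulVec]
    abel
  have hc : ∀ k, modifiedUtility Qε Qy R η y u k
      = η k ⬝ᵥ Q *ᵥ η k + u k ⬝ᵥ R *ᵥ u k := fun k => by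
    rw [modifiedUtility, hy, hxM, hQdef, Matrix.add_mulVec, dotProduct_add,
      ← Matrix.mulVec_mulVec, ← Matrix.mulVec_mulVec, dotProduct_transpose_mulVec, dotProduct_comm (Qy *ᵥ _),
      ← Matrix.mulVec_mulVec]
  have hcard : (regPi η u kN).rank = Fintype.card (ParamIdx (EtaIdx n m p) (Fin m)) := by
    have hnz : Fintype.card (EtaIdx n m p) = n * (m + p + 1) := by
      simp only [EtaIdx, Fintype.card_sum, Fintype.card_prod, Fintype.card_fin]; ring
    rw [hPi, card_paramIdx, hnz, Fintype.card_fin]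
  have hrun := isVIRun_modelRun (kN := kN) (caux := inputUtility R u) hlin hc (fun k => rfl) hQ hR
    hP0
  refine ⟨_, hrun, fun s' hs' => hs'.unique hcard hrun, ?_⟩
  obtain ⟨j, hj⟩ := exists_posDef_weight_sub_increment hQ hR hP0.nonneg
    (isSchur_augmentedMatrix_sub hL hAε hηε0 hK hMdef)
  refine ⟨j, ?_⟩
  rw [← neg_sub, ← bigH_modelRun hQ hR hP0] at hj
  exact hj.submatrix (e := fun i : Fin n => (Sum.inr (Sum.inr i) : EtaIdx n m p))
    (Sum.inr_injective.comp Sum.inr_injective)
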